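/- Let $p,n\ge 0$ be integers and consider the autonomous system of second order ODEs $$\frac{d^2x_i}{dt^2}+2G^i\Big(\mu;x,\frac{dx}{dt}\Big)=0,\qquad i=1,\dots,n,$$ where $x=(x_1,\dots,x_n)$ are the unknowns, $\mu=(\mu_1,\dots,\mu_p)\in\mathbb{R}^p$ are real parameters ($p=0$, i.e. no parameters, is allowed), and, writing $y=(y_1,\dots,y_n)$ for $dx/dt$, each $G^i$ is a rational function with real coefficients in the variables $(\mu,x,y)$. Throughout, the numerator and the denominator of a rational function $f\in\mathbb{R}(\mu,x,y)$ are those of a representation of $f$ in lowest terms in the polynomial ring $\mathbb{R}[\mu,x,y]$; they are written $G^{i,1},G^{i,2}$ for $G^i$, and similarly $a_{n,1},a_{n,2}$ and $\Delta_{j,1},\Delta_{j,2}$ for the functions $a_n$ and $\Delta_j$ below. The function $f$ is defined at the points where its denominator does not vanish. Put $N^i_j=\partial G^i/\partial y_j$, $G^i_{j\ell}=\partial N^i_j/\partial y_\ell$, and let $$P^i_j=-2\frac{\partial G^i}{\partial x_j}-2\sum_{\ell}G^\ell G^i_{j\ell}+\sum_\ell y_\ell\frac{\partial N^i_j}{\partial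 x_\ell}+\sum_\ell N^i_\ell N^\ell_j$$ be the deviation curvature tensor, an $n\times n$ matrix over $\mathbb{R}(\mu,x,y)$. Let $\lambda^n+a_1\lambda^{n-1}+\cdots+a_n$ be its characteristic polynomial, put $a_0=1$ and $a_i=0$ for $i<0$ or $i>n$, and for $j=1,\dots,n$ let $\Delta_j=\det\,(a_{2c-r})_{1\le r,c\le j}$ (row index $r$, column index $c$) be the $j$-th Hurwitz determinant. For a given $\mu$, a fixed point is a point $(x,y)\in\mathbb{R}^n\times\mathbb{R}^n$ with $y=0$ at which all $G^i$ are defined and satisfy $G^i(\mu,x,y)=0$. It is called Jacobi stable if all complex eigenvalues of the real matrix $(P^i_j(\mu,x,y))$ have strictly negative real part. Then for every $\mu\in\mathbb{R}^p$ and every integer $k\ge 0$, the system has exactly $k$ Jacobi stable fixed points if and only if the semi-algebraic system $$\begin{cases}G^{1,1}(\mu,x,0)=\cdots=G^{n,1}(\mu,x,0)=0,\\ G^{i,2}(\mu,x,0)\ne 0,\quad i=1,\dots,n,\\ a_{n,1}(\mu,x,0)\cdot a_{n,2}(\mu,x,0)>0,\\ \Delta_{j,1}(\mu,x,0)\cdot\Delta_{j,2}(\mu,x,0)>0,\quad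 j=1,\dots,n\end{cases}$$ has exactly $k$ distinct real solutions $x=(x_1,\dots,x_n)\in\mathbb{R}^n$. -/

import Mathlib

namespace KCC

/-- The indeterminates: the parameters `μ₁, …, μ_p`, the positions `x₁, …, x_n` and the velocities
`y₁, …, y_n` (with `y_i = dx_i/dt`). -/
inductive Var (p n : ℕ) : Type
  | param (m : Fin p) : Var p n
  | pos (i : Fin n) : Var p n
  | vel (i : Fin n) : Var p n

/-- Real polynomials in the parameters, the positions and the velocities. -/
abbrev Poly (p n : ℕ) : Type := MvPolynomial (Var p n) ℝ

/-- Rational functions in the parameters, the positions and the velocities. -/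
abbrev RatFunc (p n : ℕ) : Type := FractionRing (Poly p n)

/-- The system `x_i'' + 2 G^i(μ; x, x') = 0`, `i = 1, …, n`, given by its rational functions `G^i`.
-/
abbrev RationalSystem (p n : ℕ) : Type := Fin n → RatFunc p n

noncomputable section

/-- The numerator of a rational function, written in lowest terms. -/
def numer {p n : ℕ} (f : RatFunc p n) : Poly p n := IsFractionRing.num (Poly p n) f

/-- The denominator of a rational function, written in lowest terms. -/
def denom {p n : ℕ} (f : RatFunc p n) : Poly p n := (IsFractionRing.den (Poly p n) f : Poly p n)

/-- The point `(μ, x, y)`, as an assignment of values to the indeterminates. -/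
def point {p n : ℕ} (μ : Fin p → ℝ) (x y : Fin n → ℝ) : Var p n → ℝ
  | Var.param m => μ m
  | Var.pos i => x i
  | Var.vel i => y i

/-- A rational function is defined at a point where its denominator does not vanish. -/
def IsDefinedAt {p n : ℕ} (f : RatFunc p n) (v : Var p n → ℝ) : Prop :=
  MvPolynomial.eval v (denom f) ≠ 0

/-- The value of a rational function at a point (meaningful where the function is defined). -/
def value {p n : ℕ} (f : RatFunc p n) (v : Var p n → ℝ) : ℝ :=
  MvPolynomial.eval v (numer f) / MvPolynomial.eval v (denom f)

/-- The partial derivative of a rational function with respect to the indeterminate `s`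
(quotient rule). -/
def partialDeriv {p n : ℕ} (s : Var p n) (f : RatFunc p n) : RatFunc p n :=
  algebraMap (Poly p n) (RatFunc p n)
      (MvPolynomial.pderiv s (numer f) * denom f - numer f * MvPolynomial.pderiv s (denom f)) /
    algebraMap (Poly p n) (RatFunc p n) (denom f ^ 2)

/-- The nonlinear connection `N^i_j = ∂G^i/∂y_j`. -/
def nonlinearConnection {p n : ℕ} (G : RationalSystem p n) (i j : Fin n) : RatFunc p n :=
  partialDeriv (Var.vel j) (G i)

/-- The Berwald connection `G^i_{jl} = ∂N^i_j/∂y_l`. -/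
def berwaldConnection {p n : ℕ} (G : RationalSystem p n) (i j l : Fin n) : RatFunc p n :=
  partialDeriv (Var.vel l) (nonlinearConnection G i j)

/-- The deviation curvature tensor (second KCC invariant)
`P^i_j = -2 ∂G^i/∂x_j - 2 G^l G^i_{jl} + y_l ∂N^i_j/∂x_l + N^i_l N^l_j` (summation over `l`),
a matrix of rational functions with row index `i` and column index `j`. -/
def deviationCurvature {p n : ℕ} (G : RationalSystem p n) :
    Matrix (Fin n) (Fin n) (RatFunc p n) :=
  Matrix.of fun i j =>
    -2 * partialDeriv (Var.pos j) (G i)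
      - 2 * ∑ l, G l * berwaldConnection G i j l
      + ∑ l, algebraMap (Poly p n) (RatFunc p n) (MvPolynomial.X (Var.vel l)) *
          partialDeriv (Var.pos l) (nonlinearConnection G i j)
      + ∑ l, nonlinearConnection G i l * nonlinearConnection G l j

/-- `(x, y)` is a fixed point of the system with parameter value `μ`: the functions `G^i` are
defined at `(μ, x, y)`, and `(x, y)` is an equilibrium of the equivalent first order system
`x_i' = y_i`, `y_i' = -2 G^i(μ; x, y)`. -/
def IsFixedPoint {p n : ℕ} (G : RationalSystem p n) (μ : Fin p → ℝ) (x y : Fin n → ℝ) : Prop :=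
  (∀ i, IsDefinedAt (G i) (point μ x y)) ∧
    (∀ i, y i = 0) ∧ ∀ i, -2 * value (G i) (point μ x y) = 0

/-- The system with parameter value `μ` is Jacobi stable at `(x, y)`: all complex eigenvalues of the
deviation curvature tensor at `(μ, x, y)` have strictly negative real part. -/
def IsJacobiStableAt {p n : ℕ} (G : RationalSystem p n) (μ : Fin p → ℝ) (x y : Fin n → ℝ) : Prop :=
  ∀ z : ℂ,
    Module.End.HasEigenvalue
      (Matrix.toLin' ((deviationCurvature G).map fun f => ((value f (point μ x y) : ℝ) : ℂ))) z →
    z.re < 0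

/-- The Jacobi stable fixed points `(x, y)` of the system with parameter value `μ`. -/
def jacobiStableFixedPoints {p n : ℕ} (G : RationalSystem p n) (μ : Fin p → ℝ) :
    Set ((Fin n → ℝ) × (Fin n → ℝ)) :=
  {q | IsFixedPoint G μ q.1 q.2 ∧ IsJacobiStableAt G μ q.1 q.2}

/-- The coefficient `a_i` of the characteristic polynomial
`λ^n + a_1 λ^(n-1) + ⋯ + a_n` of the deviation curvature tensor, with `a_0 = 1` and `a_i = 0` for
`i > n`. -/
def charCoeff {p n : ℕ} (G : RationalSystem p n) (i : ℕ) : RatFunc p n :=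
  if i ≤ n then (deviationCurvature G).charpoly.coeff (n - i) else 0

/-- The `j`-th Hurwitz determinant `Δ_j`, the determinant of the `j × j` matrix whose entry in
row `r` and column `c` (counted from 1) is `a_{2c-r}`, read as `0` when `2c - r < 0`.
The indices below are counted from 0. -/
def hurwitzDet {p n : ℕ} (G : RationalSystem p n) (j : ℕ) : RatFunc p n :=
  Matrix.det (Matrix.of fun r c : Fin j =>
    if (r : ℕ) ≤ 2 * (c : ℕ) + 1 then charCoeff G (2 * (c : ℕ) + 1 - (r : ℕ)) else 0)

/-- The real solutions `x` of the semi-algebraic system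
`G^{i,1}(μ,x,0) = 0` and `G^{i,2}(μ,x,0) ≠ 0` for `1 ≤ i ≤ n`,
`a_{n,1}(μ,x,0) · a_{n,2}(μ,x,0) > 0`, and
`Δ_{j,1}(μ,x,0) · Δ_{j,2}(μ,x,0) > 0` for `1 ≤ j ≤ n`,
where the second indices 1 and 2 mark numerators and denominators. -/
def semiAlgebraicSolutions {p n : ℕ} (G : RationalSystem p n) (μ : Fin p → ℝ) :
    Set (Fin n → ℝ) :=
  {x | (∀ i, MvPolynomial.eval (point μ x 0) (numer (G i)) = 0) ∧
    (∀ i, MvPolynomial.eval (point μ x 0) (denom (G i)) ≠ 0) ∧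
    0 < MvPolynomial.eval (point μ x 0) (numer (charCoeff G n)) *
      MvPolynomial.eval (point μ x 0) (denom (charCoeff G n)) ∧
    ∀ j : ℕ, 1 ≤ j → j ≤ n →
      0 < MvPolynomial.eval (point μ x 0) (numer (hurwitzDet G j)) *
        MvPolynomial.eval (point μ x 0) (denom (hurwitzDet G j))}

end

end KCC

/-! A fixed point has `y = 0`, so the question is pointwise in `x`: where all `G^i` are defined, the
inequalities must express that the curvature matrix is stable.

Evaluation at a point `v` is not a homomorphism on all rational functions, but it is one on the
subring `definedAt v`. Lowest terms make this work: by `isDefinedAt_and_value_mul`, any fraction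
with denominator nonzero at `v` computes the value. The subring is closed under partial derivatives,
so it contains the curvature entries once it contains the `G^i`. Characteristic coefficients and
Hurwitz determinants therefore commute with evaluation (`value_charCoeff`, `value_hurwitzDet`), and
numerator times denominator has the sign of the value.

What remains is the Routh–Hurwitz criterion for real polynomials, proved by induction on the degree.
A Routh step is a Gaussian elimination step on the Hurwitz matrix (`det_hurwitzMatrix_succ`), and it
preserves and reflects stability when the first two coefficients are positive
(`isStablePoly_succ_iff`). The latter compares `|f(-z)|` with `|f(z)|` on the right half-plane, with
a maximum principle for one direction. The condition on `a_n` is redundant, because `Δ_n = a_n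
Δ_{n-1}` (`det_hurwitzMatrix_last`). -/

/-! ### Values of rational functions -/

/-- A function on a ring that is additive and multiplicative on a subring, as a homomorphism. -/
def Subring.ringHomOfFun {R S : Type*} [Ring R] [Ring S] (A : Subring R) (φ : R → S)
    (h1 : φ 1 = 1) (hadd : ∀ f ∈ A, ∀ g ∈ A, φ (f + g) = φ f + φ g)
    (hmul : ∀ f ∈ A, ∀ g ∈ A, φ (f * g) = φ f * φ g) : A →+* S :=
  RingHom.mk' ⟨⟨fun f => φ f, h1⟩, fun f g => hmul f f.2 g g.2⟩ fun f g => hadd f f.2 g g.2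

namespace KCC

open MvPolynomial

variable {p n : ℕ}

theorem denom_ne_zero (f : RatFunc p n) : denom f ≠ 0 :=
  nonZeroDivisors.coe_ne_zero _

theorem mul_denom (f : RatFunc p n) :
    f * algebraMap (Poly p n) (RatFunc p n) (denom f) =
      algebraMap (Poly p n) (RatFunc p n) (numer f) :=
  IsFractionRing.num_mul_den_eq_num_iff_eq.2 rfl

/-- Any fraction representing `f` whose denominator does not vanish at `v` computes the value
of `f` at `v`. -/
theorem isDefinedAt_and_value_mul {f : RatFunc p n} {v : Var p n → ℝ} {a b : Poly p n}
    (hb : eval v b ≠ 0)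
    (h : f * algebraMap (Poly p n) (RatFunc p n) b = algebraMap (Poly p n) (RatFunc p n) a) :
    IsDefinedAt f v ∧ value f v * eval v b = eval v a := by
  have hinj : Function.Injective (algebraMap (Poly p n) (RatFunc p n)) :=
    IsFractionRing.injective _ _
  have hcross : a * denom f = numer f * b := by
    apply hinj
    rw [map_mul, map_mul, ← mul_denom f, ← h]
    ring
  have hrel : IsRelPrime (numer f) (denom f) := IsFractionRing.num_den_reduced (Poly p n) f
  -- Lowest terms enter here: `denom f` divides `numer f * b` and is coprime to `numer f`.
  obtain ⟨e, rfl⟩ : denom f ∣ b :=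
    hrel.symm.dvd_of_dvd_mul_left (hcross ▸ dvd_mul_left _ _)
  have ha : a = numer f * e :=
    mul_right_cancel₀ (denom_ne_zero f) (by rw [hcross]; ring)
  rw [map_mul] at hb
  have hd : eval v (denom f) ≠ 0 := left_ne_zero_of_mul hb
  refine ⟨hd, ?_⟩
  rw [ha, map_mul, map_mul, value]
  field_simp

theorem isDefinedAt_of_mul {f : RatFunc p n} {v : Var p n → ℝ} {a b : Poly p n}
    (hb : eval v b ≠ 0)
    (h : f * algebraMap (Poly p n) (RatFunc p n) b = algebraMap (Poly p n) (RatFunc p n) a) :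
    IsDefinedAt f v :=
  (isDefinedAt_and_value_mul hb h).1

theorem value_eq_of_mul {f : RatFunc p n} {v : Var p n → ℝ} {a b : Poly p n}
    (hb : eval v b ≠ 0)
    (h : f * algebraMap (Poly p n) (RatFunc p n) b = algebraMap (Poly p n) (RatFunc p n) a) :
    value f v = eval v a / eval v b :=
  (eq_div_iff hb).2 (isDefinedAt_and_value_mul hb h).2

theorem algebraMap_mul_one (a : Poly p n) :
    algebraMap (Poly p n) (RatFunc p n) a * algebraMap (Poly p n) (RatFunc p n) 1 =
      algebraMap (Poly p n) (RatFunc p n) a := by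
  rw [map_one, mul_one]

theorem isDefinedAt_algebraMap (a : Poly p n) (v : Var p n → ℝ) :
    IsDefinedAt (algebraMap (Poly p n) (RatFunc p n) a) v :=
  isDefinedAt_of_mul (b := 1) (by simp) (algebraMap_mul_one a)

theorem value_algebraMap (a : Poly p n) (v : Var p n → ℝ) :
    value (algebraMap (Poly p n) (RatFunc p n) a) v = eval v a := by
  rw [value_eq_of_mul (b := 1) (by simp) (algebraMap_mul_one a)]
  simp

theorem add_mul_denom (f g : RatFunc p n) :
    (f + g) * algebraMap (Poly p n) (RatFunc p n) (denom f * denom g) =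
      algebraMap (Poly p n) (RatFunc p n) (numer f * denom g + numer g * denom f) := by
  simp only [map_mul, map_add, ← mul_denom]
  ring

theorem mul_mul_denom (f g : RatFunc p n) :
    (f * g) * algebraMap (Poly p n) (RatFunc p n) (denom f * denom g) =
      algebraMap (Poly p n) (RatFunc p n) (numer f * numer g) := by
  simp only [map_mul, ← mul_denom]
  ring

section

variable {f g : RatFunc p n} {v : Var p n → ℝ}

theorem IsDefinedAt.eval_mul_ne_zero (hf : IsDefinedAt f v) (hg : IsDefinedAt g v) :
    eval v (denom f * denom g) ≠ 0 := by
  rw [map_mul]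
  exact mul_ne_zero hf hg

theorem IsDefinedAt.add (hf : IsDefinedAt f v) (hg : IsDefinedAt g v) : IsDefinedAt (f + g) v :=
  isDefinedAt_of_mul (hf.eval_mul_ne_zero hg) (add_mul_denom f g)

theorem IsDefinedAt.mul (hf : IsDefinedAt f v) (hg : IsDefinedAt g v) : IsDefinedAt (f * g) v :=
  isDefinedAt_of_mul (hf.eval_mul_ne_zero hg) (mul_mul_denom f g)

theorem IsDefinedAt.value_add (hf : IsDefinedAt f v) (hg : IsDefinedAt g v) :
    value (f + g) v = value f v + value g v := by
  have hf' : eval v (denom f) ≠ 0 := hf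
  have hg' : eval v (denom g) ≠ 0 := hg
  rw [value_eq_of_mul (hf.eval_mul_ne_zero hg) (add_mul_denom f g), value, value]
  simp only [map_mul, map_add]
  field_simp

theorem IsDefinedAt.value_mul (hf : IsDefinedAt f v) (hg : IsDefinedAt g v) :
    value (f * g) v = value f v * value g v := by
  rw [value_eq_of_mul (hf.eval_mul_ne_zero hg) (mul_mul_denom f g), value, value]
  simp only [map_mul]
  rw [mul_div_mul_comm]

/-- The quotient rule gives a fraction over `denom f ^ 2`, perhaps not reduced, but nonzero at `v`.
-/
theorem IsDefinedAt.partialDeriv (hf : IsDefinedAt f v) (s : Var p n) :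
    IsDefinedAt (partialDeriv s f) v := by
  refine isDefinedAt_of_mul (b := denom f ^ 2) ?_ (div_mul_cancel₀ _ ?_)
  · rw [map_pow]
    exact pow_ne_zero 2 hf
  · rw [Ne, FaithfulSMul.algebraMap_eq_zero_iff]
    exact pow_ne_zero 2 (denom_ne_zero f)

/-- The value of a rational function is positive if and only if the product of its numerator and
its denominator is. -/
theorem numer_mul_denom_pos_iff :
    0 < eval v (numer f) * eval v (denom f) ↔ 0 < value f v := by
  rw [value, div_pos_iff, mul_pos_iff]

end

/-- The rational functions defined at the point `v`. -/
def definedAt (v : Var p n → ℝ) : Subring (RatFunc p n) where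
  carrier := {f | IsDefinedAt f v}
  mul_mem' := IsDefinedAt.mul
  add_mem' := IsDefinedAt.add
  one_mem' := by simpa using isDefinedAt_algebraMap (1 : Poly p n) v
  zero_mem' := by simpa using isDefinedAt_algebraMap (0 : Poly p n) v
  neg_mem' := by
    intro f hf
    have h := (isDefinedAt_algebraMap (-1 : Poly p n) v).mul hf
    rwa [map_neg, map_one, neg_one_mul] at h

theorem mem_definedAt {f : RatFunc p n} {v : Var p n → ℝ} :
    f ∈ definedAt v ↔ IsDefinedAt f v := Iff.rfl

/-- Evaluation at `v` of the rational functions defined there. -/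
noncomputable def valueHom (v : Var p n → ℝ) : definedAt v →+* ℝ :=
  (definedAt v).ringHomOfFun (fun f => value f v)
    (by have h := value_algebraMap (1 : Poly p n) v; rwa [map_one, map_one] at h)
    (fun _ hf _ hg => IsDefinedAt.value_add hf hg) (fun _ hf _ hg => IsDefinedAt.value_mul hf hg)

theorem isDefinedAt_deviationCurvature {G : RationalSystem p n} {v : Var p n → ℝ}
    (hG : ∀ i, IsDefinedAt (G i) v) (i j : Fin n) : IsDefinedAt (deviationCurvature G i j) v := by
  have hN (i j : Fin n) : IsDefinedAt (nonlinearConnection G i j) v := (hG i).partialDeriv _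
  have hX (l : Fin n) : IsDefinedAt
      (algebraMap (Poly p n) (RatFunc p n) (X (Var.vel l))) v := isDefinedAt_algebraMap _ v
  have h2 : (2 : RatFunc p n) ∈ definedAt v := ofNat_mem _ 2
  rw [← mem_definedAt, deviationCurvature, Matrix.of_apply]
  refine add_mem (add_mem (sub_mem (mul_mem (neg_mem h2) ((hG i).partialDeriv _))
    (mul_mem h2 (sum_mem fun l _ => ?_))) (sum_mem fun l _ => ?_)) (sum_mem fun l _ => ?_)
  · exact mul_mem (hG l) ((hN i j).partialDeriv _)
  · exact mul_mem (hX l) ((hN i j).partialDeriv _)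
  · exact mul_mem (hN i l) (hN l j)

end KCC

/-! ### Hurwitz matrices -/

/-- The `j`-th Hurwitz matrix of a sequence of coefficients. -/
def hurwitzMatrix {R : Type*} [Zero R] (a : ℕ → R) (j : ℕ) : Matrix (Fin j) (Fin j) R :=
  Matrix.of fun r c =>
    if (r : ℕ) ≤ 2 * (c : ℕ) + 1 then a (2 * (c : ℕ) + 1 - (r : ℕ)) else 0

theorem hurwitzMatrix_apply {R : Type*} [Zero R] (a : ℕ → R) (j : ℕ) (r c : Fin j) :
    hurwitzMatrix a j r c =
      if (r : ℕ) ≤ 2 * (c : ℕ) + 1 then a (2 * (c : ℕ) + 1 - (r : ℕ)) else 0 := rfl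

theorem hurwitzMatrix_map {R S F : Type*} [Zero R] [Zero S] [FunLike F R S] [ZeroHomClass F R S]
    (φ : F) (a : ℕ → R) (j : ℕ) :
    (hurwitzMatrix a j).map φ = hurwitzMatrix (fun i => φ (a i)) j := by
  ext r c
  simp only [Matrix.map_apply, hurwitzMatrix_apply, apply_ite φ, map_zero]

/-- The coefficients of the polynomial of lower degree obtained by one step of Routh's algorithm. -/
def routhStep {K : Type*} [Field K] (a : ℕ → K) (i : ℕ) : K :=
  if Even i then a (i + 1) else a (i + 1) - a 0 / a 1 * a (i + 2)

theorem routhStep_of_even {K : Type*} [Field K] (a : ℕ → K) {i : ℕ} (hi : Even i) :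
    routhStep a i = a (i + 1) := if_pos hi

theorem routhStep_of_not_even {K : Type*} [Field K] (a : ℕ → K) {i : ℕ} (hi : ¬Even i) :
    routhStep a i = a (i + 1) - a 0 / a 1 * a (i + 2) := if_neg hi

/-- One step of Routh's algorithm is one step of Gaussian elimination on the Hurwitz matrix. -/
theorem det_hurwitzMatrix_succ {K : Type*} [Field K] (a : ℕ → K) (ha : a 1 ≠ 0) (j : ℕ) :
    (hurwitzMatrix a (j + 1)).det = a 1 * (hurwitzMatrix (routhStep a) j).det := by
  -- Counting from 0, even rows hold the coefficients of odd index and odd rows those of even index.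
  -- Each even row, times `a 0 / a 1`, is subtracted from the row below it.
  obtain ⟨k, hk⟩ : ∃ k : ℕ → K, k = fun i => if Even i then a 0 / a 1 else 0 := ⟨_, rfl⟩
  obtain ⟨B, hB0, hBs⟩ : ∃ B : Matrix (Fin (j + 1)) (Fin (j + 1)) K,
      (∀ c, B 0 c = hurwitzMatrix a (j + 1) 0 c) ∧
      ∀ (i : Fin j) c, B i.succ c = hurwitzMatrix a (j + 1) i.succ c
        - k i * hurwitzMatrix a (j + 1) i.castSucc c :=
    ⟨Matrix.of <| Fin.cons (hurwitzMatrix a (j + 1) 0) fun i c =>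
      hurwitzMatrix a (j + 1) i.succ c - k i * hurwitzMatrix a (j + 1) i.castSucc c,
      fun _ => rfl, fun _ _ => rfl⟩
  have hAB : (hurwitzMatrix a (j + 1)).det = B.det :=
    Matrix.det_eq_of_forall_row_eq_smul_add_pred (fun i => k i) (fun c => (hB0 c).symm)
      fun i c => by rw [hBs, sub_add_cancel]
  have h01 : a 0 - a 0 / a 1 * a 1 = 0 := by rw [div_mul_cancel₀ _ ha, sub_self]
  have hcol (i : Fin j) : B i.succ 0 = 0 := by
    rw [hBs, hurwitzMatrix_apply, hurwitzMatrix_apply, hk]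
    rcases i with ⟨_ | _ | i, hi⟩
    · simpa using h01
    · simp
    · simp
  have hsub : B.submatrix (Fin.succAbove 0) Fin.succ = hurwitzMatrix (routhStep a) j := by
    ext r c
    rw [Matrix.submatrix_apply, Fin.zero_succAbove, hBs]
    simp only [hurwitzMatrix_apply, hk, Fin.val_succ, Fin.val_castSucc]
    by_cases hr : Even (r : ℕ)
    · rcases lt_trichotomy (r : ℕ) (2 * c + 2) with h | h | h
      · have hne : ¬Even (2 * (c : ℕ) + 1 - r) := by grind
        rw [if_pos (by omega), if_pos hr, if_pos (by omega), if_pos (by omega),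
          routhStep_of_not_even a hne]
        congr 3 <;> omega
      -- Boundary case `r = 2c + 2`: the reduced entry is `a 0 - (a 0 / a 1) * a 1 = 0`, matching
      -- the zero of the smaller Hurwitz matrix.
      · rw [if_pos (by omega), if_pos hr, if_pos (by omega), if_neg (by omega), ← h01]
        congr 3 <;> omega
      · have : (r : ℕ) ≠ 2 * c + 3 := by grind
        rw [if_neg (by omega), if_pos hr, if_neg (by omega), if_neg (by omega), mul_zero, sub_zero]
    · rw [if_neg hr, zero_mul, sub_zero]
      by_cases h : (r : ℕ) ≤ 2 * c + 1
      · have he : Even (2 * (c : ℕ) + 1 - r) := by grind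
        rw [if_pos (by omega), if_pos h, routhStep_of_even a he]
        congr 1
        omega
      · have : (r : ℕ) ≠ 2 * c + 2 := by grind
        rw [if_neg (by omega), if_neg h]
  rw [hAB, Matrix.det_succ_column_zero, Fin.sum_univ_succ]
  simp only [hcol, hsub, hB0, hurwitzMatrix_apply]
  simp

/-! ### The Routh–Hurwitz criterion -/

open Finset Filter Topology

section RouthHurwitz

variable (a : ℕ → ℝ) (n : ℕ) (z : ℂ)

/-- The polynomial `a₀ zⁿ + a₁ zⁿ⁻¹ + ⋯ + aₙ`. -/
noncomputable def descPoly : ℂ := ∑ i ∈ range (n + 1), (a i : ℂ) * z ^ (n - i)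

/-- The part `a₀ zⁿ + a₂ zⁿ⁻² + ⋯` of `a₀ zⁿ + a₁ zⁿ⁻¹ + ⋯ + aₙ`. -/
noncomputable def evenPart : ℂ :=
  ∑ i ∈ range (n + 1), if Even i then (a i : ℂ) * z ^ (n - i) else 0

/-- The part `a₁ zⁿ⁻¹ + a₃ zⁿ⁻³ + ⋯` of `a₀ zⁿ + a₁ zⁿ⁻¹ + ⋯ + aₙ`. -/
noncomputable def oddPart : ℂ :=
  ∑ i ∈ range (n + 1), if Even i then 0 else (a i : ℂ) * z ^ (n - i)

/-- All complex zeros of `a₀ zⁿ + a₁ zⁿ⁻¹ + ⋯ + aₙ` have negative real part. -/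
def IsStablePoly : Prop := ∀ z : ℂ, descPoly a n z = 0 → z.re < 0

/-! ### Even and odd parts under reflection and under Routh's step -/

theorem evenPart_add_oddPart : evenPart a n z + oddPart a n z = descPoly a n z := by
  rw [evenPart, oddPart, descPoly, ← sum_add_distrib]
  refine sum_congr rfl fun i _ => ?_
  split_ifs <;> simp

/-- Parity refers to the index `i`: the exponents `n - i` in `evenPart` have the parity of `n`,
those in `oddPart` the opposite one. -/
theorem descPoly_neg :
    descPoly a n (-z) = (-1) ^ n * (evenPart a n z - oddPart a n z) := by
  rw [evenPart, oddPart, descPoly, ← sum_sub_distrib, mul_sum]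
  refine sum_congr rfl fun i hi => ?_
  have hi : i ≤ n := by simpa [Nat.lt_succ_iff] using hi
  obtain ⟨m, rfl⟩ := Nat.exists_eq_add_of_le hi
  rw [Nat.add_sub_cancel_left, neg_pow, pow_add]
  split_ifs with h
  · rw [h.neg_one_pow]; ring
  · rw [(Nat.not_even_iff_odd.1 h).neg_one_pow]; ring

theorem norm_descPoly_neg :
    ‖descPoly a n (-z)‖ = ‖evenPart a n z - oddPart a n z‖ := by
  rw [descPoly_neg]; simp

theorem descPoly_conj :
    descPoly a n (starRingEnd ℂ z) = starRingEnd ℂ (descPoly a n z) := by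
  simp [descPoly]

theorem evenPart_routhStep : evenPart (routhStep a) n z = oddPart a (n + 1) z := by
  rw [evenPart, oddPart, sum_range_succ' _ (n + 1)]
  simp only [Even.zero, if_true, add_zero]
  refine sum_congr rfl fun i _ => ?_
  by_cases h : Even i
  · rw [if_pos h, if_neg (by grind), routhStep_of_even a h, Nat.add_sub_add_right]
  · rw [if_neg h, if_pos (by grind)]

variable {a n z}

/-- With `evenPart_routhStep`, this makes Routh's step a Euclidean division of the even part by the
odd part, with quotient `(a 0 / a 1) z`. -/
theorem oddPart_routhStep (h1 : a 1 ≠ 0) (ha : a (n + 2) = 0) :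
    oddPart (routhStep a) n z =
      evenPart a (n + 1) z - (a 0 / a 1 : ℝ) * z * oddPart a (n + 1) z := by
  have hodd : z * oddPart a (n + 1) z = (a 1 : ℂ) * z ^ (n + 1) +
      ∑ i ∈ range (n + 1), if Even i then 0 else (a (i + 2) : ℂ) * z ^ (n - i) := by
    -- The added term `i = n + 2` vanishes by `ha`; it makes the sum line up after the shift of the
    -- index by 2.
    have h : z * oddPart a (n + 1) z =
        ∑ i ∈ range (n + 3), if Even i then 0 else (a i : ℂ) * z ^ (n + 2 - i) := by
      rw [sum_range_succ, ha, oddPart, mul_sum]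
      simp only [Complex.ofReal_zero, zero_mul, ite_self, add_zero]
      refine sum_congr rfl fun i hi => ?_
      have hi : i ≤ n + 1 := by simpa [Nat.lt_succ_iff] using hi
      rw [show n + 2 - i = n + 1 - i + 1 by omega, pow_succ]
      split_ifs <;> ring
    rw [h, sum_range_succ', sum_range_succ']
    simp only [Even.zero, if_true, add_zero, zero_add, Nat.not_even_one, if_false]
    rw [add_comm]
    congr 1
    refine sum_congr rfl fun i _ => ?_
    by_cases h : Even i
    · rw [if_pos h, if_pos (by grind)]
    · rw [if_neg h, if_neg (by grind), Nat.add_sub_add_right n 2 i]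
  have heven : evenPart a (n + 1) z = (a 0 : ℂ) * z ^ (n + 1) +
      ∑ i ∈ range (n + 1), if Even i then 0 else (a (i + 1) : ℂ) * z ^ (n - i) := by
    rw [evenPart, sum_range_succ', add_comm]
    simp only [Even.zero, if_true]
    congr 1
    refine sum_congr rfl fun i _ => ?_
    by_cases h : Even i
    · rw [if_pos h, if_neg (by grind)]
    · rw [if_neg h, if_pos (by grind), Nat.add_sub_add_right]
  have h1' : (a 1 : ℂ) ≠ 0 := by exact_mod_cast h1
  rw [mul_assoc, hodd, heven, mul_add, ← mul_assoc]
  rw [show ((a 0 / a 1 : ℝ) : ℂ) * a 1 = a 0 by push_cast; field_simp, add_sub_add_left_eq_sub,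
    mul_sum, ← sum_sub_distrib, oddPart]
  refine sum_congr rfl fun i _ => ?_
  by_cases h : Even i
  · simp only [if_pos h, mul_zero, sub_zero]
  · simp only [if_neg h, routhStep_of_not_even a h]
    push_cast
    ring

/-! ### Roots in the left half-plane and the Hermite–Biehler inequality -/

/-- Whether `‖p - q‖ < ‖p + q‖` is decided by the sign of `Re (p q̄)`. -/
theorem norm_add_sq_sub_norm_sub_sq (p q : ℂ) :
    ‖p + q‖ ^ 2 - ‖p - q‖ ^ 2 = 4 * (p * starRingEnd ℂ q).re := by
  simp only [Complex.sq_norm, Complex.normSq_apply, Complex.add_re, Complex.add_im,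
    Complex.sub_re, Complex.sub_im, Complex.mul_re, Complex.conj_re, Complex.conj_im]
  ring

theorem re_mul_conj_nonneg_of_norm_le {p q : ℂ} (h : ‖p - q‖ ≤ ‖p + q‖) :
    0 ≤ (p * starRingEnd ℂ q).re := by
  have h1 := norm_add_sq_sub_norm_sub_sq p q
  have h2 := pow_le_pow_left₀ (norm_nonneg _) h 2
  linarith

theorem re_mul_conj_pos_of_norm_lt {p q : ℂ} (h : ‖p - q‖ < ‖p + q‖) :
    0 < (p * starRingEnd ℂ q).re := by
  have h1 := norm_add_sq_sub_norm_sub_sq p q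
  have h2 := pow_lt_pow_left₀ h (norm_nonneg _) two_ne_zero
  linarith

theorem re_div_eq (p q : ℂ) : (p / q).re = (p * starRingEnd ℂ q).re / Complex.normSq q := by
  rw [Complex.div_re, Complex.mul_re, Complex.conj_re, Complex.conj_im]
  ring

theorem norm_multiset_prod_sub_le {s : Multiset ℂ} (hs : ∀ r ∈ s, r.re < 0) {z : ℂ}
    (hz : 0 < z.re) :
    0 < ‖(s.map (z - ·)).prod‖ ∧
      ‖(s.map (-starRingEnd ℂ z - ·)).prod‖ ≤ ‖(s.map (z - ·)).prod‖ ∧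
      (s ≠ 0 → ‖(s.map (-starRingEnd ℂ z - ·)).prod‖ < ‖(s.map (z - ·)).prod‖) := by
  induction s using Multiset.induction with
  | empty => simp
  | cons r s ih =>
    obtain ⟨hpos, hle, -⟩ := ih fun w hw => hs w (Multiset.mem_cons_of_mem hw)
    have hr : r.re < 0 := hs r (Multiset.mem_cons_self r s)
    -- The squared distances differ by `-4 Re z Re r > 0`: the mirror image of `z` in the imaginary
    -- axis is nearer to `r`.
    have hlt : ‖-starRingEnd ℂ z - r‖ < ‖z - r‖ := by
      refine lt_of_pow_lt_pow_left₀ 2 (norm_nonneg _) ?_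
      simp only [Complex.sq_norm, Complex.normSq_apply, Complex.sub_re, Complex.sub_im,
        Complex.neg_re, Complex.neg_im, Complex.conj_re, Complex.conj_im]
      nlinarith
    have hlt' : ‖((r ::ₘ s).map (-starRingEnd ℂ z - ·)).prod‖ <
        ‖((r ::ₘ s).map (z - ·)).prod‖ := by
      simp only [Multiset.map_cons, Multiset.prod_cons, norm_mul]
      exact (mul_le_mul_of_nonneg_left hle (norm_nonneg _)).trans_lt
        (mul_lt_mul_of_pos_right hlt hpos)
    exact ⟨(norm_nonneg _).trans_lt hlt', hlt'.le, fun _ => hlt'⟩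

variable (a n) in
/-- The polynomial `a₀ Xⁿ + a₁ Xⁿ⁻¹ + ⋯ + aₙ`. -/
noncomputable def toPoly : Polynomial ℂ :=
  ∑ i ∈ range (n + 1), Polynomial.C (a i : ℂ) * Polynomial.X ^ (n - i)

theorem eval_toPoly : (toPoly a n).eval z = descPoly a n z := by
  simp [toPoly, descPoly, Polynomial.eval_finsetSum]

theorem coeff_toPoly {i : ℕ} (hi : i ≤ n) : (toPoly a n).coeff (n - i) = a i := by
  rw [toPoly, Polynomial.finsetSum_coeff, sum_eq_single i]
  · simp
  · intro j hj hji
    have hj : j ≤ n := by simpa [Nat.lt_succ_iff] using hj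
    rw [Polynomial.coeff_C_mul_X_pow, if_neg (by omega)]
  · intro h
    exact absurd (by simpa [Nat.lt_succ_iff] using hi) h

theorem natDegree_toPoly (h0 : a 0 ≠ 0) : (toPoly a n).natDegree = n := by
  refine Polynomial.natDegree_eq_of_le_of_coeff_ne_zero ?_ ?_
  · refine Polynomial.natDegree_sum_le_of_forall_le _ _ fun i _ => ?_
    exact (Polynomial.natDegree_C_mul_X_pow_le _ _).trans (Nat.sub_le _ _)
  · have := coeff_toPoly (a := a) (Nat.zero_le n)
    rw [Nat.sub_zero] at this
    rw [this]
    exact_mod_cast h0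

theorem leadingCoeff_toPoly (h0 : a 0 ≠ 0) : (toPoly a n).leadingCoeff = a 0 := by
  rw [Polynomial.leadingCoeff, natDegree_toPoly h0]
  exact coeff_toPoly (Nat.zero_le n)

theorem IsStablePoly.roots (h : IsStablePoly a n) :
    ∀ r ∈ (toPoly a n).roots, r.re < 0 := fun r hr =>
  h r (by rw [← eval_toPoly]; exact (Polynomial.mem_roots'.1 hr).2)

theorem descPoly_eq_prod (h0 : a 0 ≠ 0) :
    descPoly a n z = a 0 * ((toPoly a n).roots.map (z - ·)).prod := by
  rw [← eval_toPoly, (IsAlgClosed.splits (toPoly a n)).eval_eq_prod_roots, leadingCoeff_toPoly h0]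

theorem card_roots_toPoly (h0 : a 0 ≠ 0) : (toPoly a n).roots.card = n := by
  rw [← (IsAlgClosed.splits (toPoly a n)).natDegree_eq_card_roots, natDegree_toPoly h0]

/-- Real coefficients allow `-z` to be replaced by the mirror image of `z`, whose distance to each
root can be compared with that of `z`. -/
theorem norm_descPoly_neg_eq : ‖descPoly a n (-z)‖ = ‖descPoly a n (-starRingEnd ℂ z)‖ := by
  rw [← map_neg, descPoly_conj, RCLike.norm_conj]

/-- The Hermite–Biehler inequality. -/
theorem IsStablePoly.norm_le (h : IsStablePoly a n) (h0 : a 0 ≠ 0) (hz : 0 < z.re) :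
    ‖descPoly a n (-z)‖ ≤ ‖descPoly a n z‖ := by
  rw [norm_descPoly_neg_eq, descPoly_eq_prod h0, descPoly_eq_prod h0, norm_mul, norm_mul]
  exact mul_le_mul_of_nonneg_left (norm_multiset_prod_sub_le h.roots hz).2.1 (norm_nonneg _)

theorem IsStablePoly.norm_lt (h : IsStablePoly a n) (h0 : a 0 ≠ 0) (hn : n ≠ 0) (hz : 0 < z.re) :
    ‖descPoly a n (-z)‖ < ‖descPoly a n z‖ := by
  rw [norm_descPoly_neg_eq, descPoly_eq_prod h0, descPoly_eq_prod h0, norm_mul, norm_mul]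
  refine mul_lt_mul_of_pos_left ((norm_multiset_prod_sub_le h.roots hz).2.2 ?_) (by simpa using h0)
  rwa [Ne, ← Multiset.card_eq_zero, card_roots_toPoly h0]

/-- By Vieta, `-a 1 / a 0` is the sum of the `n + 1 ≥ 1` roots, all with negative real part. -/
theorem IsStablePoly.coeff_one_pos (h : IsStablePoly a (n + 1)) (h0 : 0 < a 0) : 0 < a 1 := by
  have hv := (IsAlgClosed.splits (toPoly a (n + 1))).nextCoeff_eq_neg_sum_roots_mul_leadingCoeff
  rw [leadingCoeff_toPoly h0.ne', Polynomial.nextCoeff_of_natDegree_pos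
    (by rw [natDegree_toPoly h0.ne']; omega), natDegree_toPoly h0.ne', coeff_toPoly (by omega)] at hv
  have hre : a 1 = -a 0 * ((toPoly a (n + 1)).roots.map Complex.re).sum := by
    have := congrArg Complex.re hv
    rw [← Complex.ofReal_neg, Complex.re_ofReal_mul, Complex.ofReal_re] at this
    rw [this, ← Complex.coe_reAddGroupHom, map_multiset_sum]
  have hneg (s : Multiset ℂ) (hs : ∀ r ∈ s, r.re < 0) (hne : s ≠ 0) : (s.map Complex.re).sum < 0 := by
    have := Multiset.sum_lt_sum_of_nonempty hne (f := Complex.re) (g := fun _ => 0) hs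
    simpa using this
  have hsum := hneg _ h.roots (by
    rw [Ne, ← Multiset.card_eq_zero, card_roots_toPoly h0.ne']; omega)
  rw [hre]
  nlinarith


/-! ### Routh's step reflects stability -/

theorem evenPart_eq_zero_and_oddPart_eq_zero (hz : z.re = 0) (h : descPoly a n z = 0) :
    evenPart a n z = 0 ∧ oddPart a n z = 0 := by
  -- On the imaginary axis conjugation is negation, so `-z` is a zero too; sum and difference of the
  -- parts both vanish.
  have hconj : starRingEnd ℂ z = -z := by
    apply Complex.ext <;> simp [hz]
  have hadd : evenPart a n z + oddPart a n z = 0 := by rw [evenPart_add_oddPart, h]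
  have hsub : evenPart a n z - oddPart a n z = 0 := by
    rw [← norm_eq_zero, ← norm_descPoly_neg, ← hconj, descPoly_conj, h, map_zero, norm_zero]
  constructor
  · linear_combination (hadd + hsub) / 2
  · linear_combination (hadd - hsub) / 2

theorem evenPart_eq_add (h1 : a 1 ≠ 0) (ha : a (n + 2) = 0) :
    evenPart a (n + 1) z =
      oddPart (routhStep a) n z + (a 0 / a 1 : ℝ) * z * evenPart (routhStep a) n z := by
  rw [oddPart_routhStep h1 ha, evenPart_routhStep]
  ring

theorem routhStep_zero : routhStep a 0 = a 1 := routhStep_of_even a Even.zero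

/-- With `p`, `q` the parts of the reduced polynomial and `c = a 0 / a 1`, the original one is `p +
q + c z p`. A zero with `Re z ≥ 0` would force `p = q = 0`, hence a zero of the reduced polynomial
at the same point. -/
theorem IsStablePoly.of_routhStep (h0 : 0 < a 0) (h1 : 0 < a 1) (ha : a (n + 2) = 0)
    (h : IsStablePoly (routhStep a) n) : IsStablePoly a (n + 1) := by
  intro z hz
  by_contra! hre
  suffices hpq : evenPart (routhStep a) n z = 0 ∧ oddPart (routhStep a) n z = 0 by
    have := h z (by rw [← evenPart_add_oddPart, hpq.1, hpq.2, add_zero])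
    linarith
  have hE := evenPart_eq_add (z := z) h1.ne' ha
  rcases hre.eq_or_lt with hre | hre
  · obtain ⟨h3, h4⟩ := evenPart_eq_zero_and_oddPart_eq_zero hre.symm hz
    rw [evenPart_routhStep] at hE ⊢
    rw [h3, h4, mul_zero, add_zero] at hE
    exact ⟨h4, hE.symm⟩
  · have hle := h.norm_le (by rw [routhStep_zero]; exact h1.ne') hre
    rw [norm_descPoly_neg, ← evenPart_add_oddPart] at hle
    have hnn := re_mul_conj_nonneg_of_norm_le hle
    rw [← evenPart_add_oddPart, ← evenPart_routhStep, hE] at hz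
    obtain ⟨c, hc, hc0⟩ : ∃ c, c = a 0 / a 1 ∧ 0 < c := ⟨_, rfl, div_pos h0 h1⟩
    rw [← hc] at hz
    generalize evenPart (routhStep a) n z = p at *
    generalize oddPart (routhStep a) n z = q at *
    obtain rfl : q = -(1 + c * z) * p := by linear_combination hz
    have hval : (p * starRingEnd ℂ (-(1 + c * z) * p)).re =
        -(1 + c * z.re) * Complex.normSq p := by
      rw [map_mul, mul_left_comm, Complex.mul_conj, mul_comm, Complex.re_ofReal_mul]
      simp
      ring
    -- Hermite–Biehler gives `Re (p q̄) ≥ 0`, while `hval` makes it `-(1 + c Re z) |p|²`.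
    have hp : Complex.normSq p = 0 := by
      have := Complex.normSq_nonneg p
      have : 0 < c * z.re := mul_pos hc0 hre
      nlinarith
    rw [Complex.normSq_eq_zero] at hp
    simp [hp]

/-! ### Behaviour at infinity, a maximum principle, and preservation of stability -/

theorem tendsto_sum_mul_pow_sub_div_pow (b : ℕ → ℂ) (n : ℕ) :
    Tendsto (fun z : ℂ => (∑ i ∈ range (n + 1), b i * z ^ (n - i)) / z ^ n)
      (Bornology.cobounded ℂ) (𝓝 (b 0)) := by
  have hlim : Tendsto (fun z : ℂ => ∑ i ∈ range (n + 1), b i * z⁻¹ ^ i)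
      (Bornology.cobounded ℂ) (𝓝 (∑ i ∈ range (n + 1), b i * 0 ^ i)) :=
    tendsto_finsetSum _ fun i _ => (tendsto_inv₀_cobounded.pow i).const_mul _
  rw [sum_range_succ', sum_eq_zero fun i _ => by simp, zero_add, pow_zero, mul_one] at hlim
  refine hlim.congr' ?_
  filter_upwards [Bornology.eventually_ne_cobounded (0 : ℂ)] with z hz
  rw [sum_div]
  refine sum_congr rfl fun i hi => ?_
  have hi : i ≤ n := by simpa [Nat.lt_succ_iff] using hi
  rw [mul_div_assoc, pow_sub₀ z hz hi, inv_pow]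
  field_simp

theorem tendsto_oddPart_div_evenPart (h0 : a 0 ≠ 0) :
    Tendsto (fun z : ℂ => oddPart a n z / evenPart a n z) (Bornology.cobounded ℂ) (𝓝 0) := by
  have hE := tendsto_sum_mul_pow_sub_div_pow (fun i => if Even i then (a i : ℂ) else 0) n
  have hO := tendsto_sum_mul_pow_sub_div_pow (fun i => if Even i then 0 else (a i : ℂ)) n
  simp only [Even.zero, if_true, ite_mul, zero_mul] at hE hO
  have h := hO.div hE (by exact_mod_cast h0)
  rw [zero_div] at h
  refine h.congr' ?_
  filter_upwards [Bornology.eventually_ne_cobounded (0 : ℂ)] with z hz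
  exact div_div_div_cancel_right₀ (pow_ne_zero n hz) _ _

theorem differentiable_evenPart : Differentiable ℂ (evenPart a n) := by
  unfold evenPart
  refine Differentiable.fun_sum fun i _ => ?_
  split_ifs <;> fun_prop

theorem differentiable_oddPart : Differentiable ℂ (oddPart a n) := by
  unfold oddPart
  refine Differentiable.fun_sum fun i _ => ?_
  split_ifs <;> fun_prop

/-- A holomorphic function on the right half-plane that tends to `0` at infinity and whose real
part is at least `-c Re z` has nonnegative real part. -/
theorem re_nonneg_of_neg_mul_re_le {φ : ℂ → ℂ} {c : ℝ} (hc : 0 ≤ c)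
    (hd : ∀ z : ℂ, 0 < z.re → DifferentiableAt ℂ φ z)
    (hlim : Tendsto φ (Bornology.cobounded ℂ) (𝓝 0))
    (hle : ∀ z : ℂ, 0 < z.re → -(c * z.re) ≤ (φ z).re) {w : ℂ} (hw : 0 < w.re) :
    0 ≤ (φ w).re := by
  -- Nothing is known on the imaginary axis, so the maximum principle is applied on `Re z > ε`
  -- inside a large disc. The bound is `-cε` on the line and `-ε` on the arc.
  have key (ε : ℝ) (hε : 0 < ε) (hεw : ε < w.re) : -((c + 1) * ε) ≤ (φ w).re := by
    obtain ⟨R, hR⟩ : ∃ R : ℝ, ∀ z : ℂ, R < ‖z‖ → ‖φ z‖ < ε := by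
      have h1 : ∀ᶠ z in Bornology.cobounded ℂ, ‖φ z‖ < ε := by
        have := hlim.norm
        rw [norm_zero] at this
        exact this.eventually_lt_const hε
      obtain ⟨R, -, hR⟩ := (Metric.hasBasis_cobounded_compl_closedBall (0 : ℂ)).eventually_iff.1 h1
      exact ⟨R, fun z hz => hR (by simpa using hz)⟩
    -- The radius exceeds `R`, so that `φ` is small on the arc, and `‖w‖`, so that `w` is inside.
    set S : ℝ := max (R + 1) (‖w‖ + 1) with hS
    set U : Set ℂ := {z | ε < z.re} ∩ Metric.ball 0 S with hU
    have hclos : closure U ⊆ {z | ε ≤ z.re} := by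
      refine closure_minimal (fun z hz => (show ε < z.re from hz.1).le) ?_
      exact isClosed_le continuous_const Complex.continuous_re
    have hbound : ∀ z ∈ frontier U, -((c + 1) * ε) ≤ (φ z).re := by
      intro z hz
      have hzre : ε ≤ z.re := hclos (frontier_subset_closure hz)
      rcases frontier_inter_subset _ _ hz with ⟨h1, -⟩ | ⟨-, h2⟩
      · rw [Complex.frontier_setOfPred_lt_re] at h1
        have h1 : z.re = ε := h1
        have := hle z (by linarith)
        rw [h1] at this
        linarith
      · have h2 : ‖z‖ = S := by simpa using Metric.frontier_ball_subset_sphere h2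
        have h3 := hR z (by rw [h2, hS]; exact lt_of_lt_of_le (by linarith) (le_max_left _ _))
        have h4 := (abs_le.1 (Complex.abs_re_le_norm (φ z))).1
        have : 0 ≤ c * ε := by positivity
        linarith
    have hdiff : DiffContOnCl ℂ (fun z => Complex.exp (-φ z)) U := by
      refine DifferentiableOn.diffContOnCl fun z hz => ?_
      have hz : ε ≤ z.re := hclos hz
      exact (hd z (by linarith)).neg.cexp.differentiableWithinAt
    -- Since `|exp (-φ)| = exp (-Re φ)`, maximum modulus becomes a lower bound for `Re φ`.
    have hmax := Complex.norm_le_of_forall_mem_frontier_norm_le (U := U)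
      (Metric.isBounded_ball.subset Set.inter_subset_right) hdiff
      (C := Real.exp ((c + 1) * ε)) (fun z hz => ?_) (z := w) (subset_closure ⟨hεw, ?_⟩)
    · rw [Complex.norm_exp, Real.exp_le_exp, Complex.neg_re] at hmax
      linarith
    · rw [Complex.norm_exp, Real.exp_le_exp, Complex.neg_re]
      linarith [hbound z hz]
    · rw [mem_ball_zero_iff, hS]
      exact lt_of_lt_of_le (by linarith) (le_max_right _ _)
  by_contra! hneg
  -- This makes `(c + 1) ε` at most half of `-Re φ(w)`, against `key`.
  set ε : ℝ := min (w.re / 2) (-(φ w).re / (2 * (c + 1))) with hε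
  have hε0 : 0 < ε := lt_min (by linarith) (div_pos (by linarith) (by linarith))
  have h1 := key ε hε0 (lt_of_le_of_lt (min_le_left _ _) (by linarith))
  have h2 : ε ≤ -(φ w).re / (2 * (c + 1)) := min_le_right _ _
  rw [le_div_iff₀ (by linarith)] at h2
  linarith

/-- Stability makes `Re (E / O) > 0` on the right half-plane for the even and odd parts `E`, `O`. As
`E / O = φ + c z` with `φ = q / p` for the reduced polynomial `p + q` and `c = a 0 / a 1`, the
maximum principle gives `Re φ ≥ 0`, whereas a zero of `p + q` there would need `φ = -1`. -/
theorem IsStablePoly.routhStep (h0 : 0 < a 0) (ha : a (n + 2) = 0)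
    (h : IsStablePoly a (n + 1)) : IsStablePoly (routhStep a) n := by
  have h1 : 0 < a 1 := h.coeff_one_pos h0
  have hpos (z : ℂ) (hz : 0 < z.re) :
      0 < (evenPart a (n + 1) z * starRingEnd ℂ (oddPart a (n + 1) z)).re := by
    have hlt := h.norm_lt h0.ne' n.succ_ne_zero hz
    rw [norm_descPoly_neg, ← evenPart_add_oddPart] at hlt
    exact re_mul_conj_pos_of_norm_lt hlt
  have hne (z : ℂ) (hz : 0 < z.re) : evenPart (_root_.routhStep a) n z ≠ 0 := by
    intro h2
    have := hpos z hz
    rw [← evenPart_routhStep, h2, map_zero, mul_zero] at this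
    exact lt_irrefl _ this
  intro w hw
  by_contra! hre
  rcases hre.eq_or_lt with hre | hre
  · obtain ⟨h3, h4⟩ := evenPart_eq_zero_and_oddPart_eq_zero hre.symm hw
    have := h w (by
      rw [← evenPart_add_oddPart, evenPart_eq_add h1.ne' ha, ← evenPart_routhStep, h3, h4]
      simp)
    linarith
  · have hφ := re_nonneg_of_neg_mul_re_le (c := a 0 / a 1)
      (φ := fun z => oddPart (_root_.routhStep a) n z / evenPart (_root_.routhStep a) n z)
      (div_nonneg h0.le h1.le)
      (fun z hz => (differentiable_oddPart z).div (differentiable_evenPart z) (hne z hz))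
      (tendsto_oddPart_div_evenPart (by rw [routhStep_zero]; exact h1.ne')) (fun z hz => ?_) hre
    · rw [← evenPart_add_oddPart] at hw
      rw [eq_neg_of_add_eq_zero_right hw, neg_div, div_self (hne w hre)] at hφ
      norm_num at hφ
    · have hq := div_pos (hpos z hz) (Complex.normSq_pos.2 (evenPart_routhStep a n z ▸ hne z hz))
      rw [← re_div_eq, evenPart_eq_add h1.ne' ha, ← evenPart_routhStep, add_div,
        mul_div_cancel_right₀ _ (hne z hz), Complex.add_re, Complex.re_ofReal_mul] at hq
      linarith

/-! ### Induction on the degree -/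

theorem isStablePoly_zero (h0 : a 0 ≠ 0) : IsStablePoly a 0 := by
  intro z hz
  simp [descPoly, h0] at hz

theorem isStablePoly_succ_iff (h0 : 0 < a 0) (ha : a (n + 2) = 0) :
    IsStablePoly a (n + 1) ↔ 0 < a 1 ∧ IsStablePoly (routhStep a) n :=
  ⟨fun h => ⟨h.coeff_one_pos h0, h.routhStep h0 ha⟩, fun h => h.2.of_routhStep h0 h.1 ha⟩

theorem det_hurwitzMatrix_one {R : Type*} [CommRing R] (a : ℕ → R) :
    (hurwitzMatrix a 1).det = a 1 := by
  simp [hurwitzMatrix_apply]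

/-- The Routh–Hurwitz criterion. -/
theorem isStablePoly_iff_det_hurwitzMatrix_pos (n : ℕ) (a : ℕ → ℝ) (h0 : 0 < a 0)
    (ha : ∀ i, n < i → a i = 0) :
    IsStablePoly a n ↔ ∀ j, 1 ≤ j → j ≤ n → 0 < (hurwitzMatrix a j).det := by
  induction n generalizing a with
  | zero => exact ⟨fun _ j h1 h2 => by omega, fun _ => isStablePoly_zero h0.ne'⟩
  | succ n ih =>
    rw [isStablePoly_succ_iff h0 (ha _ (by omega))]
    have hstep (h1 : 0 < a 1) : IsStablePoly (routhStep a) n ↔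
        ∀ j, 1 ≤ j → j ≤ n → 0 < (hurwitzMatrix (routhStep a) j).det := by
      refine ih _ (by rwa [routhStep_zero]) fun i hi => ?_
      rw [routhStep, ha (i + 1) (by omega), ha (i + 2) (by omega)]
      simp
    constructor
    · rintro ⟨h1, hs⟩ j hj hjn
      obtain ⟨j, rfl⟩ := Nat.exists_eq_add_of_le' hj
      rw [det_hurwitzMatrix_succ a h1.ne']
      refine mul_pos h1 ?_
      rcases Nat.eq_zero_or_pos j with rfl | hj0
      · simp
      · exact (hstep h1).1 hs j hj0 (by omega)
    · intro h
      have h1 : 0 < a 1 := det_hurwitzMatrix_one a ▸ h 1 le_rfl (by omega)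
      refine ⟨h1, (hstep h1).2 fun j hj hjn => ?_⟩
      have := h (j + 1) (by omega) (by omega)
      rw [det_hurwitzMatrix_succ a h1.ne'] at this
      exact pos_of_mul_pos_right this h1.le

/-- The last Hurwitz determinant is the product of the last coefficient and the last but one
Hurwitz determinant. -/
theorem det_hurwitzMatrix_last {R : Type*} [CommRing R] (n : ℕ) (a : ℕ → R)
    (ha : ∀ i, n + 1 < i → a i = 0) :
    (hurwitzMatrix a (n + 1)).det = a (n + 1) * (hurwitzMatrix a n).det := by
  have hcol (i : Fin n) : hurwitzMatrix a (n + 1) i.castSucc (Fin.last n) = 0 := by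
    have := i.2
    rw [hurwitzMatrix_apply, Fin.val_castSucc, Fin.val_last, ha _ (by omega), ite_self]
  have hlast : hurwitzMatrix a (n + 1) (Fin.last n) (Fin.last n) = a (n + 1) := by
    rw [hurwitzMatrix_apply, Fin.val_last, if_pos (by omega)]
    congr 1
    omega
  have hsub : (hurwitzMatrix a (n + 1)).submatrix (Fin.last n).succAbove (Fin.last n).succAbove =
      hurwitzMatrix a n := by
    ext r c
    simp [hurwitzMatrix_apply]
  rw [Matrix.det_succ_column _ (Fin.last n), Fin.sum_univ_castSucc]
  simp only [hcol, hlast, hsub]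
  simp

end RouthHurwitz

/-! ### Jacobi stable fixed points -/

namespace KCC

variable {p n : ℕ} {G : RationalSystem p n} {v : Var p n → ℝ}

theorem hurwitzDet_eq (G : RationalSystem p n) (j : ℕ) :
    hurwitzDet G j = (hurwitzMatrix (charCoeff G) j).det := rfl

/-- The deviation curvature tensor at the point `v`. -/
noncomputable def curvatureAt (G : RationalSystem p n) (v : Var p n → ℝ) :
    Matrix (Fin n) (Fin n) ℝ :=
  (deviationCurvature G).map fun f => value f v

/-- The coefficient `a_i` of the characteristic polynomial `λ^n + a_1 λ^(n-1) + ⋯ + a_n` of a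
matrix. -/
noncomputable def charpolyDescCoeff {R : Type*} [CommRing R] (A : Matrix (Fin n) (Fin n) R)
    (i : ℕ) : R :=
  if i ≤ n then A.charpoly.coeff (n - i) else 0

theorem charpolyDescCoeff_map {R S : Type*} [CommRing R] [CommRing S] (φ : R →+* S)
    (A : Matrix (Fin n) (Fin n) R) (i : ℕ) :
    charpolyDescCoeff (A.map φ) i = φ (charpolyDescCoeff A i) := by
  rw [charpolyDescCoeff, charpolyDescCoeff, Matrix.charpoly_map, Polynomial.coeff_map,
    apply_ite φ, map_zero]

theorem charCoeff_eq (G : RationalSystem p n) :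
    charCoeff G = charpolyDescCoeff (deviationCurvature G) := rfl

theorem charpolyDescCoeff_zero {R : Type*} [CommRing R] [Nontrivial R]
    (A : Matrix (Fin n) (Fin n) R) : charpolyDescCoeff A 0 = 1 := by
  have h := A.charpoly_monic.coeff_natDegree
  rwa [A.charpoly_natDegree_eq_dim, Fintype.card_fin] at h

theorem charpolyDescCoeff_of_lt {R : Type*} [CommRing R] (A : Matrix (Fin n) (Fin n) R) {i : ℕ}
    (hi : n < i) : charpolyDescCoeff A i = 0 := if_neg (by omega)

/-- A real matrix has only eigenvalues with negative real part if and only if its characteristic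
polynomial is stable. -/
theorem forall_hasEigenvalue_re_neg_iff (A : Matrix (Fin n) (Fin n) ℝ) :
    (∀ z : ℂ, Module.End.HasEigenvalue (Matrix.toLin' (A.map ((↑) : ℝ → ℂ))) z → z.re < 0) ↔
      IsStablePoly (charpolyDescCoeff A) n := by
  have heval (z : ℂ) : (A.map ((↑) : ℝ → ℂ)).charpoly.eval z =
      descPoly (charpolyDescCoeff A) n z := by
    have hmap : (A.map ((↑) : ℝ → ℂ)).charpoly = A.charpoly.map Complex.ofRealHom :=
      Matrix.charpoly_map A Complex.ofRealHom
    rw [hmap, Polynomial.eval_map, Polynomial.eval₂_eq_sum_range, A.charpoly_natDegree_eq_dim,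
      Fintype.card_fin, descPoly, ← Finset.sum_range_reflect]
    refine Finset.sum_congr rfl fun i hi => ?_
    have hi : i ≤ n := by simpa [Nat.lt_succ_iff] using hi
    rw [charpolyDescCoeff, if_pos hi, show n + 1 - 1 - i = n - i by omega]
    rfl
  refine forall_congr' fun z => ?_
  rw [Module.End.hasEigenvalue_iff_isRoot_charpoly, Matrix.charpoly_toLin', Polynomial.IsRoot, heval]

/-- When all `G^i` are defined at `v`, the deviation curvature tensor is a matrix over the ring of
rational functions defined at `v`. -/
theorem exists_matrix_definedAt (hG : ∀ i, IsDefinedAt (G i) v) :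
    ∃ M : Matrix (Fin n) (Fin n) (definedAt v),
      M.map (definedAt v).subtype = deviationCurvature G ∧ M.map (valueHom v) = curvatureAt G v :=
  ⟨Matrix.of fun i j => ⟨deviationCurvature G i j, isDefinedAt_deviationCurvature hG i j⟩,
    rfl, rfl⟩

theorem value_charCoeff (hG : ∀ i, IsDefinedAt (G i) v) (i : ℕ) :
    value (charCoeff G i) v = charpolyDescCoeff (curvatureAt G v) i := by
  obtain ⟨M, hM, hMv⟩ := exists_matrix_definedAt hG
  rw [charCoeff_eq, ← hM, ← hMv, charpolyDescCoeff_map, charpolyDescCoeff_map]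
  rfl

theorem value_hurwitzDet (hG : ∀ i, IsDefinedAt (G i) v) (j : ℕ) :
    value (hurwitzDet G j) v = (hurwitzMatrix (charpolyDescCoeff (curvatureAt G v)) j).det := by
  obtain ⟨M, hM, hMv⟩ := exists_matrix_definedAt hG
  -- Applied to both the inclusion into the rational functions and the evaluation at `v`.
  have key {S : Type} [CommRing S] (φ : definedAt v →+* S) :
      (hurwitzMatrix (charpolyDescCoeff (M.map φ)) j).det =
        φ (hurwitzMatrix (charpolyDescCoeff M) j).det := by
    rw [RingHom.map_det, RingHom.mapMatrix_apply, hurwitzMatrix_map]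
    simp only [← charpolyDescCoeff_map]
  rw [hurwitzDet_eq, charCoeff_eq, ← hM, ← hMv, key, key]
  rfl

theorem isJacobiStableAt_iff {μ : Fin p → ℝ} {x y : Fin n → ℝ} :
    IsJacobiStableAt G μ x y ↔ ∀ j, 1 ≤ j → j ≤ n →
      0 < (hurwitzMatrix (charpolyDescCoeff (curvatureAt G (point μ x y))) j).det := by
  rw [← isStablePoly_iff_det_hurwitzMatrix_pos n _
    (by rw [charpolyDescCoeff_zero]; exact one_pos) fun i => charpolyDescCoeff_of_lt _,
    ← forall_hasEigenvalue_re_neg_iff]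
  rfl

theorem isFixedPoint_zero_iff {μ : Fin p → ℝ} {x : Fin n → ℝ} :
    IsFixedPoint G μ x 0 ↔ (∀ i, MvPolynomial.eval (point μ x 0) (numer (G i)) = 0) ∧
      ∀ i, MvPolynomial.eval (point μ x 0) (denom (G i)) ≠ 0 := by
  simp only [IsFixedPoint, Pi.zero_apply, implies_true, true_and]
  constructor
  · rintro ⟨hd, hv⟩
    refine ⟨fun i => ?_, hd⟩
    have hi : value (G i) (point μ x 0) = 0 := by linarith [hv i]
    exact (div_eq_zero_iff.1 hi).resolve_right (hd i)
  · rintro ⟨hv, hd⟩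
    refine ⟨hd, fun i => ?_⟩
    rw [value, hv i, zero_div, mul_zero]

theorem mem_semiAlgebraicSolutions_iff {μ : Fin p → ℝ} {x : Fin n → ℝ} :
    x ∈ semiAlgebraicSolutions G μ ↔ IsFixedPoint G μ x 0 ∧ IsJacobiStableAt G μ x 0 := by
  rw [isFixedPoint_zero_iff, and_assoc]
  change _ ∧ _ ∧ _ ↔ _
  refine and_congr_right fun _ => and_congr_right fun hd => ?_
  simp only [numer_mul_denom_pos_iff]
  rw [isJacobiStableAt_iff, value_charCoeff hd]
  simp only [value_hurwitzDet hd]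
  -- The condition on `a_n` follows from the others: `a_0 = 1` if `n = 0`, and otherwise `Δ_n = a_n
  -- Δ_{n-1}`, where `Δ_0 = 1`.
  refine and_iff_right_of_imp fun h => ?_
  cases n with
  | zero => rw [charpolyDescCoeff_zero]; exact one_pos
  | succ n =>
    have hlast := h (n + 1) (by omega) le_rfl
    rw [det_hurwitzMatrix_last n _ fun i => charpolyDescCoeff_of_lt _] at hlast
    refine pos_of_mul_pos_left hlast ?_
    rcases Nat.eq_zero_or_pos n with rfl | hn
    · simp
    · exact (h n hn (by omega)).le

/-- The Jacobi stable fixed points are the points `(x, 0)` with `x` a solution of the semi-algebraic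
system. -/
theorem jacobiStableFixedPoints_eq_image (G : RationalSystem p n) (μ : Fin p → ℝ) :
    jacobiStableFixedPoints G μ = (fun x => (x, 0)) '' semiAlgebraicSolutions G μ := by
  ext ⟨x, y⟩
  simp only [Set.mem_image, Prod.mk.injEq]
  constructor
  · rintro ⟨hf, hs⟩
    obtain rfl : y = 0 := funext hf.2.1
    exact ⟨x, mem_semiAlgebraicSolutions_iff.2 ⟨hf, hs⟩, rfl, rfl⟩
  · rintro ⟨_, hx, rfl, rfl⟩
    exact mem_semiAlgebraicSolutions_iff.1 hx

end KCC

theorem mainTheorem1 (p n : ℕ) (G : KCC.RationalSystem p n) (μ : Fin p → ℝ) (k : ℕ) :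
    (KCC.jacobiStableFixedPoints G μ).encard = (k : ℕ∞) ↔
      (KCC.semiAlgebraicSolutions G μ).encard = (k : ℕ∞) := by
  rw [KCC.jacobiStableFixedPoints_eq_image,
    Function.Injective.encard_image fun _ _ h => congrArg Prod.fst h]
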